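/- Let $G=BS(1,2)=\langle a,b\mid ab=ba^2\rangle$ and let $BS^+(1,2)=\{b^ma^x : m,x\in\mathbb{Z},\ m\ge 0\}\subseteq G$, a submonoid of $G$. Let $S\subseteq BS^+(1,2)$ be a finite set that meets at least two left cosets $g\langle a\rangle$ of the subgroup $\langle a\rangle$ (equivalently, there are integers $0\le m<n$ such that $S$ meets both $b^m\langle a\rangle$ and $b^n\langle a\rangle$; in particular $|S|\ge 2$). If $S$ is non-abelian, i.e. the subgroup $\langle S\rangle$ of $G$ generated by $S$ is not abelian, then $$|S^2|\ \ge\ 3.5\,|S|-4,\qquad\text{where } S^2=\{st : s,t\in S\}.$$ -/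

import Mathlib

open scoped Pointwise

/-- The defining relator of `BS(m, n) = ⟨a, b | a ^ m * b = b * a ^ n⟩`, written in the free group
on two letters: the letter `0` stands for `a` and the letter `1` stands for `b`. -/
def baumslagSolitarRel (m n : ℤ) : FreeGroup (Fin 2) :=
  (FreeGroup.of 0 ^ m * FreeGroup.of 1) * (FreeGroup.of 1 * FreeGroup.of 0 ^ n)⁻¹

/-- The Baumslag-Solitar group `BS(m, n) = ⟨a, b | a ^ m * b = b * a ^ n⟩`. -/
abbrev BaumslagSolitar (m n : ℤ) : Type :=
  PresentedGroup ({baumslagSolitarRel m n} : Set (FreeGroup (Fin 2)))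

namespace BaumslagSolitar

/-- The generator `a` of `BS(m, n)`. -/
def a (m n : ℤ) : BaumslagSolitar m n := PresentedGroup.of 0

/-- The generator `b` of `BS(m, n)`. -/
def b (m n : ℤ) : BaumslagSolitar m n := PresentedGroup.of 1

theorem a_zpow_mul_b (m n : ℤ) : a m n ^ m * b m n = b m n * a m n ^ n := by
  have h : PresentedGroup.mk ({baumslagSolitarRel m n} : Set (FreeGroup (Fin 2)))
      (baumslagSolitarRel m n) = 1 := PresentedGroup.one_of_mem (Set.mem_singleton _)
  exact mul_inv_eq_one.mp h

theorem a_zpow_mul_b_one_two (x : ℤ) :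
    a 1 2 ^ x * b 1 2 = b 1 2 * a 1 2 ^ (2 * x) := by
  have h : SemiconjBy (b 1 2) (a 1 2 ^ (2 : ℤ)) (a 1 2) := by
    have h1 := a_zpow_mul_b 1 2
    rw [zpow_one] at h1
    exact h1.symm
  rw [zpow_mul]
  exact (h.zpow_right x).symm

theorem a_zpow_mul_b_pow_one_two (x : ℤ) (m : ℕ) :
    a 1 2 ^ x * b 1 2 ^ m = b 1 2 ^ m * a 1 2 ^ (2 ^ m * x) := by
  induction m with
  | zero => simp
  | succ m ih =>
    rw [pow_succ, ← mul_assoc, ih, mul_assoc, a_zpow_mul_b_one_two, ← mul_assoc, ← mul_assoc]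
    congr 2
    ring

end BaumslagSolitar

/-- The monoid `BS⁺(1, 2) = {b ^ m * a ^ x : m, x ∈ ℤ, m ≥ 0}` inside the group `BS(1, 2)`. -/
def BSPlus : Submonoid (BaumslagSolitar 1 2) where
  carrier := {g | ∃ (m : ℕ) (x : ℤ),
    g = BaumslagSolitar.b 1 2 ^ m * BaumslagSolitar.a 1 2 ^ x}
  one_mem' := ⟨0, 0, by simp⟩
  mul_mem' := by
    rintro _ _ ⟨r, x, rfl⟩ ⟨s, y, rfl⟩
    refine ⟨r + s, 2 ^ s * x + y, ?_⟩
    rw [pow_add, zpow_add, mul_assoc, ← mul_assoc (BaumslagSolitar.a 1 2 ^ x),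
      BaumslagSolitar.a_zpow_mul_b_pow_one_two]
    simp only [mul_assoc]

/-- A subset `S` of a group is non-abelian if the subgroup generated by `S` is not abelian. -/
def Set.IsNonabelian {G : Type*} [Group G] (S : Set G) : Prop :=
  ¬ ∀ g ∈ Subgroup.closure S, ∀ h ∈ Subgroup.closure S, g * h = h * g

/-! Acting on ℚ, `b ^ m * a ^ x` is the map y ↦ (y + x) / 2 ^ m. For m > 0 it has the single fixed
point x / (2 ^ m - 1), and two such maps commute exactly when their fixed points agree. The
lexicographic order on (level, shift) is invariant under multiplication on both sides, so |AB| ≥ |A|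
+ |B| - 1 for nonempty sets, and a slice `U` of positive level has |U²| ≥ 3|U| - 2.

The bound 7|S| ≤ 2|S²| + 8 follows by induction on `S`, removing the top slice `U` and keeping the
rest `T`. If `T` is non-abelian and meets two levels, it suffices that `U` creates at least 3.5|U|
new products; the tight case of two singleton slices is `card_add_four_le`. The induction stops when
`T` is a single slice (`card_two_levels`) or abelian (`card_mul_self_of_commute`). The factor 3.5
comes from slices of levels 0 and m: level 0 is a copy of ℤ, where |A + A| alone can be as small as
2|A| - 1, and `card_add_self_add_card_union_dilate` gains the rest from A ∪ 2 ^ m A. -/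

/-- The pairs `(m, x)` that encode the elements `b ^ m * a ^ x` of `BS⁺(1, 2)`. -/
@[ext]
structure LevelPair where
  /-- The exponent of `b`. -/
  level : ℕ
  /-- The exponent of `a`. -/
  shift : ℤ

/-! ### The ordered semigroup of pairs and its commutation relation. -/

namespace LevelPair

instance : Mul LevelPair := ⟨fun g h => ⟨g.level + h.level, 2 ^ h.level * g.shift + h.shift⟩⟩

@[simp] theorem level_mul (g h : LevelPair) : (g * h).level = g.level + h.level := rfl

@[simp] theorem shift_mul (g h : LevelPair) :
    (g * h).shift = 2 ^ h.level * g.shift + h.shift := rfl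

instance : Semigroup LevelPair where
  mul_assoc g h k := by
    ext
    · simp [add_assoc]
    · simp only [shift_mul, level_mul]; ring

noncomputable instance : LinearOrder LevelPair :=
  LinearOrder.lift' (fun g : LevelPair => toLex (g.level, g.shift)) fun g h hgh => by
    have := Prod.mk.inj (toLex.injective hgh)
    exact LevelPair.ext this.1 this.2

theorem lt_iff {g h : LevelPair} :
    g < h ↔ g.level < h.level ∨ g.level = h.level ∧ g.shift < h.shift := by
  change toLex (g.level, g.shift) < toLex (h.level, h.shift) ↔ _
  rw [Prod.Lex.toLex_lt_toLex]

instance : MulLeftStrictMono LevelPair := ⟨fun _ _ _ hgh => by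
  rw [lt_iff] at hgh ⊢
  rcases hgh with h1 | ⟨h1, h2⟩
  · left; simpa using h1
  · right; simpa [h1] using h2⟩

instance : MulRightStrictMono LevelPair := ⟨fun _ _ _ hgh => by
  rw [lt_iff] at hgh ⊢
  rcases hgh with h1 | ⟨h1, h2⟩
  · left; simpa [Function.swap] using h1
  · right; simpa [Function.swap, h1] using h2⟩

instance : IsCancelMul LevelPair where
  mul_left_cancel k _ _ hgh := (mul_right_strictMono (a := k)).injective hgh
  mul_right_cancel k _ _ hgh := (mul_left_strictMono (a := k)).injective hgh

instance : MulLeftMono LevelPair := ⟨fun k _ _ hgh => (mul_right_strictMono (a := k)).monotone hgh⟩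

instance : MulRightMono LevelPair := ⟨fun k _ _ hgh => (mul_left_strictMono (a := k)).monotone hgh⟩

/-- With both levels positive, this is equality of the fixed points shift / (2 ^ level - 1), cleared
of denominators. -/
theorem commute_iff {g h : LevelPair} :
    Commute g h ↔ (2 ^ h.level - 1) * g.shift = (2 ^ g.level - 1) * h.shift := by
  rw [Commute, SemiconjBy, LevelPair.ext_iff]
  simp only [level_mul, shift_mul, add_comm, true_and]
  constructor <;> intro h <;> linarith

theorem two_pow_sub_one_pos {m : ℕ} (hm : 0 < m) : (0 : ℤ) < 2 ^ m - 1 := by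
  have := one_lt_pow₀ (one_lt_two : (1 : ℤ) < 2) hm.ne'
  linarith

/-- Commutation is transitive through an element of positive level. -/
theorem commute_trans {g h k : LevelPair} (hh : 0 < h.level) (h1 : Commute g h)
    (h2 : Commute h k) : Commute g k := by
  rw [commute_iff] at *
  have := two_pow_sub_one_pos hh
  apply mul_left_cancel₀ this.ne'
  linear_combination (2 ^ k.level - 1) * h1 + (2 ^ g.level - 1) * h2

theorem eq_of_commute {g h k : LevelPair} (hk : 0 < k.level) (h1 : Commute g k)
    (h2 : Commute h k) (h3 : g.level = h.level) : g = h := by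
  rw [commute_iff] at h1 h2
  have := two_pow_sub_one_pos hk
  refine LevelPair.ext h3 (mul_left_cancel₀ this.ne' ?_)
  rw [h1, h2, h3]

/-! ### Product sets in the ordered semigroup. -/

open Finset

/-- Adjoining a new maximum `u` above the old maximum `v` adds `u * v`, `v * u` and `u * u`, all
larger than every old product and distinct because `u` and `v` do not commute. -/
theorem card_mul_self_of_not_commute (U : Finset LevelPair)
    (hU : ∀ g ∈ U, ∀ h ∈ U, g < h → ¬ Commute g h) : 3 * #U ≤ #(U * U) + 2 := by
  induction U using Finset.induction_on_max with
  | empty => simp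
  | insert u U hmax ih =>
    rcases U.eq_empty_or_nonempty with rfl | hne
    · simp
    have ih := ih fun g hg h hh => hU g (mem_insert_of_mem hg) h (mem_insert_of_mem hh)
    set v := U.max' hne
    have hv : v ∈ U := U.max'_mem hne
    have hvu : v < u := hmax v hv
    have hle : ∀ p ∈ U * U, p ≤ v * v := by
      intro p hp
      obtain ⟨g, hg, h, hh, rfl⟩ := mem_mul.1 hp
      exact mul_le_mul' (U.le_max' g hg) (U.le_max' h hh)
    have h1 : v * v < u * v := mul_lt_mul_left hvu v
    have h2 : v * v < v * u := mul_lt_mul_right hvu v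
    have h3 : u * v < u * u := mul_lt_mul_right hvu u
    have h4 : v * u < u * u := mul_lt_mul_left hvu u
    have h5 : v * u ≠ u * v := hU v (mem_insert_of_mem hv) u (mem_insert_self _ _) hvu
    have hdisj : Disjoint (U * U) {u * v, v * u, u * u} := by
      rw [disjoint_left]
      intro p hp hp'
      have := hle p hp
      simp only [mem_insert, mem_singleton] at hp'
      rcases hp' with rfl | rfl | rfl
      · exact this.not_gt h1
      · exact this.not_gt h2
      · exact this.not_gt (h1.trans h3)
    have hsub : (U * U) ∪ {u * v, v * u, u * u} ⊆ insert u U * insert u U := by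
      have hu' := mem_insert_self u U
      have hv' := mem_insert_of_mem (b := u) hv
      refine union_subset (mul_subset_mul (subset_insert _ _) (subset_insert _ _)) ?_
      simp only [insert_subset_iff, singleton_subset_iff]
      exact ⟨mul_mem_mul hu' hv', mul_mem_mul hv' hu', mul_mem_mul hu' hu'⟩
    have hcard := card_le_card hsub
    rw [card_union_of_disjoint hdisj, card_eq_three.2 ⟨_, _, _, h5.symm, h3.ne, h4.ne, rfl⟩]
      at hcard
    rw [card_insert_of_notMem fun h => (hmax u h).false]
    omega

theorem card_mul_self_of_level_pos {U : Finset LevelPair} {m : ℕ} (hm : 0 < m)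
    (hU : ∀ g ∈ U, g.level = m) : 3 * #U ≤ #(U * U) + 2 :=
  card_mul_self_of_not_commute U fun g hg h hh hlt hc =>
    hlt.ne (eq_of_commute (k := h) (hU h hh ▸ hm) hc (Commute.refl h)
      ((hU g hg).trans (hU h hh).symm))

/-- Otherwise xV = Vx. For the least `v` in `V` not commuting with `x`, the smaller of `x * v` and
`v * x` then also arises on the other side from some `v' < v`; this `v'` commutes with `x`, and
cancellation gives `v' = v`. -/
theorem card_lt_card_mul_union_mul {x v₀ : LevelPair} {V : Finset LevelPair} (hv₀ : v₀ ∈ V)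
    (h₀ : ¬ Commute x v₀) : #V + 1 ≤ #(({x} * V) ∪ (V * {x})) := by
  classical
  have hxV : {x} * V = V.image (x * ·) := by ext; simp [mem_mul]
  have hVx : V * {x} = V.image (· * x) := by ext; simp [mem_mul]
  rw [hxV, hVx]
  have h1 : #(V.image (x * ·)) = #V := card_image_of_injective _ (mul_right_injective x)
  have h2 : #(V.image (· * x)) = #V := card_image_of_injective _ (mul_left_injective x)
  by_contra! hlt
  have hl : V.image (x * ·) = V.image (x * ·) ∪ V.image (· * x) :=
    eq_of_subset_of_card_le subset_union_left (by omega)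
  have hr : V.image (· * x) = V.image (x * ·) ∪ V.image (· * x) :=
    eq_of_subset_of_card_le subset_union_right (by omega)
  have heq : V.image (x * ·) = V.image (· * x) := hl.trans hr.symm
  set W := V.filter fun v => ¬ Commute x v
  have hW : W.Nonempty := ⟨v₀, mem_filter.2 ⟨hv₀, h₀⟩⟩
  set v := W.min' hW
  obtain ⟨hvV, hv⟩ := mem_filter.1 (W.min'_mem hW)
  have key : ∀ v' ∈ V, v' < v → x * v' = v' * x := by
    intro v' hv' hlt
    by_contra hc
    exact (W.min'_le v' (mem_filter.2 ⟨hv', hc⟩)).not_gt hlt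
  rcases lt_or_gt_of_ne (show x * v ≠ v * x from hv) with h | h
  · have : x * v ∈ V.image (· * x) := heq ▸ mem_image_of_mem _ hvV
    obtain ⟨v', hv', he⟩ := mem_image.1 this
    have hlt : v' < v := lt_of_mul_lt_mul_right' (a := x) (he.trans_lt h)
    have := key v' hv' hlt
    exact hlt.ne (mul_left_cancel (this.trans he))
  · have : v * x ∈ V.image (x * ·) := heq ▸ mem_image_of_mem _ hvV
    obtain ⟨v', hv', he⟩ := mem_image.1 this
    have hlt : v' < v := lt_of_mul_lt_mul_left' (a := x) (he.trans_lt h)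
    have := key v' hv' hlt
    exact hlt.ne (mul_right_cancel (this.symm.trans he))

end LevelPair

/-! ### Sums and dilates of integer sets; two levels. -/

namespace LevelPair
open Finset

theorem card_add_self_add_card_union_dilate {m : ℕ} (hm : 0 < m) (A : Finset ℤ) {x : ℤ}
    (hx : x ∈ A) (hx0 : x ≠ 0) :
    7 * #A ≤ 2 * #(A + A) + 2 * #(A ∪ A.image (2 ^ m * ·)) + 3 := by
  obtain ⟨n, hn⟩ : ∃ n, n = x.natAbs := ⟨_, rfl⟩
  induction n using Nat.strong_induction_on generalizing A x with
  | _ n ih =>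
  -- Halving a set of even numbers preserves all three cardinalities; the nonzero element `x` makes
  -- the descent terminate.
  by_cases heven : ∀ a ∈ A, Even a
  · have h2 : Function.Injective ((2 : ℤ) * ·) := mul_right_injective₀ two_ne_zero
    obtain ⟨B, rfl⟩ : ∃ B : Finset ℤ, A = B.image (2 * ·) := by
      refine ⟨A.image (· / 2), ?_⟩
      rw [image_image]
      refine (image_id.symm.trans (image_congr fun a ha => ?_))
      obtain ⟨c, rfl⟩ := heven a ha
      simp only [id, Function.comp]
      omega
    obtain ⟨y, hy, rfl⟩ := mem_image.1 hx
    have hadd : B.image ((2 : ℤ) * ·) + B.image (2 * ·) = (B + B).image (2 * ·) :=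
      (image_add (AddMonoidHom.mulLeft (2 : ℤ))).symm
    have hdil : (B.image ((2 : ℤ) * ·)).image (2 ^ m * ·) =
        (B.image (2 ^ m * ·)).image (2 * ·) := by
      simp only [image_image]
      exact image_congr fun a _ => by simp only [Function.comp]; ring
    rw [hadd, hdil, ← image_union, card_image_of_injective _ h2, card_image_of_injective _ h2,
      card_image_of_injective _ h2]
    exact ih y.natAbs (by omega) B hy (by omega) rfl
  · push Not at heven
    obtain ⟨o, ho, hodd⟩ := heven
    set E := A.filter fun a => Even a
    set O := A.filter fun a => ¬ Even a
    have hO : O.Nonempty := ⟨o, mem_filter.2 ⟨ho, hodd⟩⟩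
    have hEO : #E + #O = #A := card_filter_add_card_filter_not _
    have hd : #(A.image ((2 : ℤ) ^ m * ·)) = #A :=
      card_image_of_injective _ (mul_right_injective₀ (pow_ne_zero _ two_ne_zero))
    have hinter : #(A ∩ A.image ((2 : ℤ) ^ m * ·)) ≤ #E := by
      refine card_le_card fun a ha => ?_
      obtain ⟨ha, ha'⟩ := mem_inter.1 ha
      obtain ⟨c, -, rfl⟩ := mem_image.1 ha'
      exact mem_filter.2 ⟨ha, (Even.mul_right ((even_two).pow_of_ne_zero hm.ne') c)⟩
    have hunion := card_union_add_card_inter A (A.image ((2 : ℤ) ^ m * ·))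
    have hAA := cauchy_davenport_add_of_linearOrder_isCancelAdd ⟨x, hx⟩ (⟨x, hx⟩ : A.Nonempty)
    rcases E.eq_empty_or_nonempty with hE | hE
    · rw [hE, card_empty] at hinter
      omega
    have hEE := cauchy_davenport_add_of_linearOrder_isCancelAdd hE hE
    have hEOs := cauchy_davenport_add_of_linearOrder_isCancelAdd hE hO
    have hdisj : Disjoint (E + E) (E + O) := by
      rw [disjoint_left]
      intro p hp hp'
      obtain ⟨a, ha, b, hb, rfl⟩ := mem_add.1 hp
      obtain ⟨c, hc, d, hd, he⟩ := mem_add.1 hp'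
      have ha := (mem_filter.1 ha).2
      have hb := (mem_filter.1 hb).2
      have hc := (mem_filter.1 hc).2
      have hd := (mem_filter.1 hd).2
      have := ha.add hb
      rw [← he, Int.even_add] at this
      tauto
    have hsub : (E + E) ∪ (E + O) ⊆ A + A :=
      union_subset (add_subset_add (filter_subset _ _) (filter_subset _ _))
        (add_subset_add (filter_subset _ _) (filter_subset _ _))
    have := card_le_card hsub
    rw [card_union_of_disjoint hdisj] at this
    have := hE.card_pos
    -- The two bounds 2|A| - 1 and 3|E| + |O| - 2 for |A + A| are added; the union has at least 2|A|
    -- - |E| elements.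
    omega

theorem mk_injective (m : ℕ) : Function.Injective (LevelPair.mk m) :=
  fun _ _ h => (LevelPair.mk.inj h).2

theorem eq_image_mk {U : Finset LevelPair} {m : ℕ} (hU : ∀ g ∈ U, g.level = m) :
    U = (U.image shift).image (LevelPair.mk m) := by
  rw [image_image]
  refine image_id.symm.trans (image_congr fun g hg => ?_)
  exact LevelPair.ext (hU g hg) rfl

theorem image_mk_mul_image_mk (m n : ℕ) (A B : Finset ℤ) :
    A.image (mk m) * B.image (mk n) = (A.image (2 ^ n * ·) + B).image (mk (m + n)) := by
  ext g
  simp only [mem_mul, mem_image, mem_add]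
  constructor
  · rintro ⟨_, ⟨a, ha, rfl⟩, _, ⟨b, hb, rfl⟩, rfl⟩
    exact ⟨2 ^ n * a + b, ⟨2 ^ n * a, ⟨a, ha, rfl⟩, b, hb, rfl⟩, rfl⟩
  · rintro ⟨_, ⟨_, ⟨a, ha, rfl⟩, b, hb, rfl⟩, rfl⟩
    exact ⟨mk m a, ⟨a, ha, rfl⟩, mk n b, ⟨b, hb, rfl⟩, rfl⟩

theorem card_level_zero_mul {m : ℕ} (hm : 0 < m) {A B : Finset ℤ} (hA : A.Nonempty)
    (hB : B.Nonempty) :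
    7 * #A + 2 * #B ≤ 2 * #(A.image (mk 0) * A.image (mk 0)) +
      2 * #(B.image (mk m) * A.image (mk 0) ∪ A.image (mk 0) * B.image (mk m)) + 5 := by
  have hVV : A.image (mk 0) * A.image (mk 0) = (A + A).image (mk 0) := by
    simp [image_mk_mul_image_mk]
  have hUV : B.image (mk m) * A.image (mk 0) ∪ A.image (mk 0) * B.image (mk m) =
      (B + (A ∪ A.image (2 ^ m * ·))).image (mk m) := by
    simp [image_mk_mul_image_mk, add_union, image_union, add_comm]
  rw [hVV, hUV, card_image_of_injective _ (mk_injective 0),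
    card_image_of_injective _ (mk_injective m)]
  have hcd := cauchy_davenport_add_of_linearOrder_isCancelAdd hB
    (hA.mono subset_union_left : (A ∪ A.image ((2 : ℤ) ^ m * ·)).Nonempty)
  have hBpos := hB.card_pos
  by_cases h0 : ∃ x ∈ A, x ≠ 0
  · obtain ⟨x, hx, hx0⟩ := h0
    have := card_add_self_add_card_union_dilate hm A hx hx0
    omega
  -- The descent needs a nonzero element; for `A = {0}` the claim is an equality.
  · push Not at h0
    obtain rfl : A = {0} := eq_singleton_iff_nonempty_unique_mem.2 ⟨hA, h0⟩
    simp only [image_singleton, mul_zero, union_self, card_singleton, singleton_add_singleton] at *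
    omega

/-- The product set of two slices of levels `n < m`. -/
theorem card_two_levels {n m : ℕ} (hnm : n < m) {V U : Finset LevelPair} (hV : ∀ g ∈ V, g.level = n)
    (hU : ∀ g ∈ U, g.level = m) (hVne : V.Nonempty) (hUne : U.Nonempty) :
    7 * (#V + #U) ≤ 2 * (#(V * V) + #(U * V ∪ V * U) + #(U * U)) + 8 := by
  have hUU := card_mul_self_of_level_pos (by omega) hU
  have hVpos := hVne.card_pos
  have hUpos := hUne.card_pos
  rcases n.eq_zero_or_pos with rfl | hn
  · have h := card_level_zero_mul hnm (hVne.image shift) (hUne.image shift)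
    rw [← eq_image_mk hV, ← eq_image_mk hU] at h
    have h1 : #(V.image shift) = #V := by
      conv_rhs => rw [eq_image_mk hV, card_image_of_injective _ (mk_injective 0)]
    have h2 : #(U.image shift) = #U := by
      conv_rhs => rw [eq_image_mk hU, card_image_of_injective _ (mk_injective m)]
    omega
  · have hVV := card_mul_self_of_level_pos hn hV
    have hUV := cauchy_davenport_mul_of_linearOrder_isCancelMul hUne hVne
    have := card_le_card (subset_union_left : U * V ⊆ U * V ∪ V * U)
    omega

/-! ### New products created by the top level. -/

/-- The products that involve the top level, together with those of the lower levels. -/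
theorem card_add_card_add_card_le {n m : ℕ} (hnm : n < m) {T V U : Finset LevelPair} (hVT : V ⊆ T)
    (hT : ∀ g ∈ T, g.level ≤ n) (hV : ∀ g ∈ V, g.level = n) (hU : ∀ g ∈ U, g.level = m) :
    #(T * T) + #(U * V ∪ V * U) + #(U * U) ≤ #((T ∪ U) * (T ∪ U)) := by
  have hTT : ∀ p ∈ T * T, p.level ≤ 2 * n := by
    intro p hp
    obtain ⟨g, hg, h, hh, rfl⟩ := mem_mul.1 hp
    have := hT g hg
    have := hT h hh
    simp only [level_mul]
    omega
  have hUV : ∀ p ∈ U * V ∪ V * U, p.level = n + m := by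
    intro p hp
    rcases mem_union.1 hp with hp | hp <;> obtain ⟨g, hg, h, hh, rfl⟩ := mem_mul.1 hp
    · rw [level_mul, hU g hg, hV h hh, add_comm]
    · rw [level_mul, hV g hg, hU h hh]
  have hUU : ∀ p ∈ U * U, p.level = m + m := by
    intro p hp
    obtain ⟨g, hg, h, hh, rfl⟩ := mem_mul.1 hp
    rw [level_mul, hU g hg, hU h hh]
  have hd1 : Disjoint (T * T) (U * V ∪ V * U) := disjoint_left.2 fun p hp hp' => by
    have := hTT p hp
    have := hUV p hp'
    omega
  have hd2 : Disjoint (T * T ∪ (U * V ∪ V * U)) (U * U) := disjoint_left.2 fun p hp hp' => by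
    have := hUU p hp'
    rcases mem_union.1 hp with hp | hp
    · have := hTT p hp
      omega
    · have := hUV p hp
      omega
  rw [← card_union_of_disjoint hd1, ← card_union_of_disjoint hd2]
  have h1 : T ⊆ T ∪ U := subset_union_left
  have h2 : U ⊆ T ∪ U := subset_union_right
  have h3 := hVT.trans h1
  exact card_le_card (union_subset (union_subset (mul_subset_mul h1 h1)
    (union_subset (mul_subset_mul h2 h3) (mul_subset_mul h3 h2))) (mul_subset_mul h2 h2))

/-- If `g * z = z * h`, then `g` and `h` have equal level and both commute with `w`, so they
coincide and commute with `z`. Positive level would make `z` commute with `w`; level zero leaves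
only the identity. Hence the two translates share at most `z`. -/
theorem card_mul_union_mul_singleton {T : Finset LevelPair} {w z : LevelPair} (hw : 0 < w.level)
    (hT : ∀ g ∈ T, Commute g w) (hzw : ¬ Commute z w) :
    2 * #T ≤ #(T * {z} ∪ {z} * T) + 1 := by
  have hinter : T * {z} ∩ ({z} * T) ⊆ {z} := by
    intro p hp
    obtain ⟨hp1, hp2⟩ := mem_inter.1 hp
    rw [mem_mul] at hp1 hp2
    simp only [mem_singleton, exists_eq_left] at hp1 hp2
    obtain ⟨g, hg, rfl⟩ := hp1
    obtain ⟨h, hh, he⟩ := hp2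
    have hlev : h.level = g.level := by
      have := congrArg level he
      simp only [level_mul] at this
      omega
    obtain rfl := eq_of_commute hw (hT h hh) (hT g hg) hlev
    rcases h.level.eq_zero_or_pos with h0 | h0
    · have hs := hT h hh
      rw [commute_iff, h0] at hs
      have hs0 : h.shift = 0 := by
        have := two_pow_sub_one_pos hw
        have h2 : (2 ^ w.level - 1 : ℤ) * h.shift = 0 := by simpa using hs
        exact (mul_eq_zero.1 h2).resolve_left this.ne'
      rw [mem_singleton]
      ext <;> simp [h0, hs0]
    · exact absurd (commute_trans h0 he (hT h hh)) hzw
  have h1 := card_le_card hinter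
  have h2 := card_union_add_card_inter (T * {z}) ({z} * T)
  rw [card_mul_singleton, card_singleton_mul] at h2
  rw [card_singleton] at h1
  omega

/-- A set whose elements below the top level commute. -/
theorem card_mul_self_of_commute {n m : ℕ} (hn : 0 < n) (hnm : n < m) {T U : Finset LevelPair}
    {w z : LevelPair} (hwT : w ∈ T) (hw : w.level = n) (hTw : ∀ g ∈ T, Commute g w)
    (hT : ∀ g ∈ T, g.level ≤ n) (hU : ∀ g ∈ U, g.level = m) (hzU : z ∈ U)
    (hzw : ¬ Commute z w) :
    4 * (#T + #U) ≤ #((T ∪ U) * (T ∪ U)) + 5 := by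
  have hTT := cauchy_davenport_mul_of_linearOrder_isCancelMul ⟨w, hwT⟩ (⟨w, hwT⟩ : T.Nonempty)
  have hUU := card_mul_self_of_level_pos (hn.trans hnm) hU
  have hX := card_mul_union_mul_singleton (hw ▸ hn) hTw hzw
  have hY := card_lt_card_mul_union_mul hzU fun h => hzw h.symm
  set X := T * {z} ∪ {z} * T with hXdef
  set Y := {w} * U ∪ U * {w} with hYdef
  have hXmem : ∀ p ∈ X, ∃ g ∈ T, p = g * z ∨ p = z * g := by
    intro p hp
    simp only [hXdef, mem_union, mem_mul, mem_singleton, exists_eq_left] at hp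
    rcases hp with ⟨g, hg, h⟩ | ⟨g, hg, h⟩
    · exact ⟨g, hg, Or.inl h.symm⟩
    · exact ⟨g, hg, Or.inr h.symm⟩
  have hYlev : ∀ p ∈ Y, p.level = n + m := by
    intro p hp
    simp only [hYdef, mem_union, mem_mul, mem_singleton, exists_eq_left] at hp
    rcases hp with ⟨g, hg, rfl⟩ | ⟨g, hg, rfl⟩
    · rw [level_mul, hU g hg, hw]
    · rw [level_mul, hU g hg, hw, add_comm]
  have hXlev : ∀ p ∈ X, p.level ≤ n + m := by
    intro p hp
    obtain ⟨g, hg, rfl | rfl⟩ := hXmem p hp <;>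
    · have := hT g hg
      have := hU z hzU
      simp only [level_mul]
      omega
  -- Only `w` in `T` has level `n`, so only `w * z` and `z * w` reach the level of `Y`.
  have hXY : #(X ∩ Y) ≤ 2 := by
    refine (card_le_card (?_ : X ∩ Y ⊆ {w * z, z * w})).trans card_le_two
    intro p hp
    obtain ⟨hpX, hpY⟩ := mem_inter.1 hp
    have hlev := hYlev p hpY
    obtain ⟨g, hg, hgp⟩ := hXmem p hpX
    have : g = w := by
      refine eq_of_commute (k := w) (hw ▸ hn) (hTw g hg) (Commute.refl w) ?_
      have := hU z hzU
      rcases hgp with rfl | rfl <;> simp only [level_mul] at hlev <;> omega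
    subst this
    simpa using hgp
  have hTTlev : ∀ p ∈ T * T, Commute p w ∧ p.level ≤ 2 * n := by
    intro p hp
    obtain ⟨g, hg, h, hh, rfl⟩ := mem_mul.1 hp
    have := hT g hg
    have := hT h hh
    refine ⟨(hTw g hg).mul_left (hTw h hh), ?_⟩
    simp only [level_mul]
    omega
  -- Levels may overlap here: products from `T` commute with `w`, whereas those in `X` do not.
  have hd1 : Disjoint (T * T) (X ∪ Y) := disjoint_left.2 fun p hp hp' => by
    obtain ⟨hpw, hplev⟩ := hTTlev p hp
    rcases mem_union.1 hp' with hpX | hpY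
    · obtain ⟨g, hg, rfl | rfl⟩ := hXmem p hpX
      · apply hzw
        refine mul_left_cancel (a := g) ?_
        rw [← mul_assoc, hpw.eq, ← mul_assoc, ← mul_assoc, (hTw g hg).eq]
      · apply hzw
        refine mul_right_cancel (b := g) ?_
        rw [mul_assoc, ← (hTw g hg).eq, ← mul_assoc, hpw.eq, mul_assoc]
    · have := hYlev p hpY
      omega
  have hd2 : Disjoint (T * T ∪ (X ∪ Y)) (U * U) := disjoint_left.2 fun p hp hp' => by
    have : p.level = m + m := by
      obtain ⟨g, hg, h, hh, rfl⟩ := mem_mul.1 hp'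
      rw [level_mul, hU g hg, hU h hh]
    rcases mem_union.1 hp with hp | hp
    · have := (hTTlev p hp).2
      omega
    rcases mem_union.1 hp with hp | hp
    · have := hXlev p hp
      omega
    · have := hYlev p hp
      omega
  have hsub : T * T ∪ (X ∪ Y) ∪ U * U ⊆ (T ∪ U) * (T ∪ U) := by
    have h1 : T ⊆ T ∪ U := subset_union_left
    have h2 : U ⊆ T ∪ U := subset_union_right
    have h3 : {z} ⊆ T ∪ U := singleton_subset_iff.2 (h2 hzU)
    have h4 : {w} ⊆ T ∪ U := singleton_subset_iff.2 (h1 hwT)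
    refine union_subset (union_subset (mul_subset_mul h1 h1) (union_subset (union_subset ?_ ?_)
      (union_subset ?_ ?_))) (mul_subset_mul h2 h2) <;> apply mul_subset_mul <;> assumption
  have hcard := card_le_card hsub
  rw [card_union_of_disjoint hd2, card_union_of_disjoint hd1] at hcard
  have := card_union_add_card_inter X Y
  have : 0 < #T := card_pos.2 ⟨w, hwT⟩
  omega

/-- Four new products arise from a top element `x` when the two top levels are singletons. -/
theorem card_add_four_le {n m : ℕ} (hn : 0 < n) (hnm : n < m) {T : Finset LevelPair}
    {x v y : LevelPair} (hx : x.level = m) (hvT : v ∈ T) (hv : v.level = n)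
    (hT : ∀ g ∈ T, g ≠ v → g.level < n) (hyT : y ∈ T) (hyx : ¬ Commute x y)
    (hTv : ∃ u ∈ T, u ≠ v) : #(T * T) + 4 ≤ #((T ∪ {x}) * (T ∪ {x})) := by
  classical
  have hTn : ∀ g ∈ T, g.level ≤ n := by
    intro g hg
    rcases eq_or_ne g v with rfl | h
    · exact hv.le
    · exact (hT g hg h).le
  have hxS : x ∈ T ∪ {x} := by simp
  have hTS : T ⊆ T ∪ {x} := subset_union_left
  suffices h : ∃ a b c d : LevelPair, a ≠ b ∧ a ≠ c ∧ a ≠ d ∧ b ≠ c ∧ b ≠ d ∧ c ≠ d ∧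
      (∀ p ∈ ({a, b, c, d} : Finset LevelPair), p ∈ (T ∪ {x}) * (T ∪ {x}) ∧ p ∉ T * T) by
    obtain ⟨a, b, c, d, hab, hac, had, hbc, hbd, hcd, h⟩ := h
    have hfour : #({a, b, c, d} : Finset LevelPair) = 4 := by
      rw [card_insert_of_notMem, card_eq_three.2 ⟨b, c, d, hbc, hbd, hcd, rfl⟩]
      simp [hab, hac, had]
    rw [← hfour, ← card_union_of_disjoint (disjoint_right.2 fun p hp => (h p hp).2)]
    exact card_le_card (union_subset (mul_subset_mul hTS hTS) fun p hp => (h p hp).1)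
  have hlow : ∀ p : LevelPair, 2 * n < p.level → p ∉ T * T := by
    intro p hp hpT
    obtain ⟨g, hg, h, hh, rfl⟩ := mem_mul.1 hpT
    have := hTn g hg
    have := hTn h hh
    simp only [level_mul] at hp
    omega
  have hne : ∀ {p q : LevelPair}, p.level ≠ q.level → p ≠ q := fun h he => h (congrArg level he)
  have hxx : x * x ∈ (T ∪ {x}) * (T ∪ {x}) ∧ x * x ∉ T * T :=
    ⟨mul_mem_mul hxS hxS, hlow _ (by rw [level_mul]; omega)⟩
  have hxv : x * v ∈ (T ∪ {x}) * (T ∪ {x}) ∧ x * v ∉ T * T :=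
    ⟨mul_mem_mul hxS (hTS hvT), hlow _ (by rw [level_mul]; omega)⟩
  by_cases hc : Commute x v
  · obtain ⟨z, hz, hmax⟩ := exists_max_image (T.filter fun g => ¬ Commute x g) level
      ⟨y, mem_filter.2 ⟨hyT, hyx⟩⟩
    obtain ⟨hzT, hzx⟩ := mem_filter.1 hz
    have hzn : z.level < n := hT z hzT fun h => hzx (h ▸ hc)
    -- As `n < m`, both factors of such a product lie above the level of `z`, hence commute with `x`
    -- by the choice of `z`; `x * z` and `z * x` do not.
    have key : ∀ p : LevelPair, p.level = m + z.level → p ∈ T * T → Commute x p := by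
      intro p hp hpT
      obtain ⟨g, hg, h, hh, rfl⟩ := mem_mul.1 hpT
      have h1 := hTn g hg
      have h2 := hTn h hh
      rw [level_mul] at hp
      have hcomm : ∀ k ∈ T, z.level < k.level → Commute x k := by
        intro k hk hlt
        by_contra hkx
        have := hmax k (mem_filter.2 ⟨hk, hkx⟩)
        omega
      exact (hcomm g hg (by omega)).mul_right (hcomm h hh (by omega))
    refine ⟨x * x, x * v, x * z, z * x, hne ?_, hne ?_, hne ?_, hne ?_, hne ?_, hzx, ?_⟩
    any_goals simp only [level_mul]; omega
    intro p hp
    simp only [mem_insert, mem_singleton] at hp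
    rcases hp with rfl | rfl | rfl | rfl
    · exact hxx
    · exact hxv
    · refine ⟨mul_mem_mul hxS (hTS hzT), fun h => hzx ?_⟩
      have := key _ (by simp only [level_mul]; omega) h
      refine mul_left_cancel (a := x) ?_
      rw [this.eq, mul_assoc]
    · refine ⟨mul_mem_mul (hTS hzT) hxS, fun h => hzx ?_⟩
      have := key _ (by simp only [level_mul]; omega) h
      refine mul_right_cancel (b := x) ?_
      rw [← this.eq, mul_assoc]
  · obtain ⟨u₀, hu₀⟩ := hTv
    obtain ⟨u, hu, hmax⟩ := exists_max_image (T.erase v) level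
      ⟨u₀, mem_erase.2 ⟨hu₀.2, hu₀.1⟩⟩
    obtain ⟨huv, huT⟩ := mem_erase.1 hu
    have hun : u.level < n := hT u huT huv
    have key : ∀ p : LevelPair, p.level = m + u.level → p ≠ v * v → p ∉ T * T := by
      intro p hp hpv hpT
      obtain ⟨g, hg, h, hh, rfl⟩ := mem_mul.1 hpT
      have h1 := hTn g hg
      have h2 := hTn h hh
      rw [level_mul] at hp
      have heq : ∀ k ∈ T, u.level < k.level → k = v := by
        intro k hk hlt
        by_contra hkv
        have := hmax k (mem_erase.2 ⟨hkv, hk⟩)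
        omega
      rw [heq g hg (by omega), heq h hh (by omega)] at hpv
      exact hpv rfl
    -- The only possible old product at this level is `v * v`. Were `x * u` and `u * x` both equal
    -- to it, `x` would commute with `v * v`, hence with `v`.
    obtain ⟨e, helev, heS, hev⟩ : ∃ e : LevelPair, e.level = m + u.level ∧
        e ∈ (T ∪ {x}) * (T ∪ {x}) ∧ e ≠ v * v := by
      by_cases hxu : x * u = v * v
      · refine ⟨u * x, by rw [level_mul]; omega, mul_mem_mul (hTS huT) hxS, fun hux => hc ?_⟩
        have h1 : Commute x (v * v) := by
          rw [← hxu]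
          exact (Commute.refl x).mul_right (hxu.trans hux.symm)
        exact commute_trans (by rw [level_mul]; omega) h1 ((Commute.refl v).mul_left (Commute.refl v))
      · exact ⟨x * u, by rw [level_mul]; omega, mul_mem_mul hxS (hTS huT), hxu⟩
    refine ⟨x * x, x * v, v * x, e, hne ?_, hne ?_, hne ?_, hc, hne ?_, hne ?_, ?_⟩
    any_goals simp only [level_mul]; omega
    intro p hp
    simp only [mem_insert, mem_singleton] at hp
    rcases hp with rfl | rfl | rfl | rfl
    · exact hxx
    · exact hxv
    · exact ⟨mul_mem_mul (hTS hvT) hxS, hlow _ (by rw [level_mul]; omega)⟩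
    · exact ⟨heS, key _ helev hev⟩

end LevelPair

/-! ### Induction on the top level. -/

namespace LevelPair
open Finset

theorem exists_not_commute {V : Finset LevelPair} {n : ℕ} (hV : ∀ g ∈ V, g.level = n)
    (hcard : 2 ≤ #V) {x : LevelPair} (hx : 0 < x.level) : ∃ v ∈ V, ¬ Commute x v := by
  by_contra! h
  obtain ⟨a, ha, b, hb, hab⟩ := one_lt_card.1 hcard
  exact hab (eq_of_commute hx (h a ha).symm (h b hb).symm ((hV a ha).trans (hV b hb).symm))

theorem seven_mul_card_le (S : Finset LevelPair) (hlev : ∃ g ∈ S, ∃ h ∈ S, g.level < h.level)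
    (hcomm : ∃ g ∈ S, ∃ h ∈ S, ¬ Commute g h) : 7 * #S ≤ 2 * #(S * S) + 8 := by
  classical
  induction S using Finset.strongInduction with
  | H S ih =>
  obtain ⟨g₁, hg₁, h₁, hh₁, hlt₁⟩ := hlev
  obtain ⟨x, hxS, hxmax⟩ := exists_max_image S level ⟨g₁, hg₁⟩
  obtain ⟨m, hm⟩ : ∃ m, x.level = m := ⟨_, rfl⟩
  rw [hm] at hxmax
  set U := S.filter fun g => g.level = m with hUdef
  set T := S.filter fun g => ¬ g.level = m with hTdef
  have hSTU : T ∪ U = S := by rw [union_comm]; exact filter_union_filter_not_eq _ S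
  have hcardS : #S = #T + #U := by
    rw [add_comm]; exact (card_filter_add_card_filter_not _).symm
  have hU : ∀ g ∈ U, g.level = m := fun g hg => (mem_filter.1 hg).2
  have hxU : x ∈ U := mem_filter.2 ⟨hxS, hm⟩
  have hTm : ∀ g ∈ T, g.level < m := fun g hg =>
    lt_of_le_of_ne (hxmax g (mem_filter.1 hg).1) (mem_filter.1 hg).2
  have hTne : T.Nonempty := ⟨g₁, mem_filter.2 ⟨hg₁, by have := hxmax h₁ hh₁; omega⟩⟩
  obtain ⟨w, hwT, hwmax⟩ := exists_max_image T level hTne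
  obtain ⟨n, hn⟩ : ∃ n, w.level = n := ⟨_, rfl⟩
  rw [hn] at hwmax
  have hnm : n < m := hn ▸ hTm w hwT
  have hUpos : 0 < #U := card_pos.2 ⟨x, hxU⟩
  by_cases hTn : ∀ g ∈ T, g.level = n
  · have h1 := card_two_levels hnm hTn hU hTne ⟨x, hxU⟩
    have h2 := card_add_card_add_card_le hnm (Subset.refl T) hwmax hTn hU
    rw [hSTU] at h2
    omega
  push Not at hTn
  obtain ⟨u, huT, hun⟩ := hTn
  have hun : u.level < n := lt_of_le_of_ne (hwmax u huT) hun
  have hn0 : 0 < n := by omega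
  by_cases hTc : ∀ g ∈ T, ∀ h ∈ T, Commute g h
  · obtain ⟨z, hzU, hzw⟩ : ∃ z ∈ U, ¬ Commute z w := by
      by_contra! hall
      have hSw : ∀ g ∈ S, Commute g w := by
        intro g hg
        rw [← hSTU, mem_union] at hg
        exact hg.elim (fun h => hTc g h w hwT) (hall g)
      obtain ⟨g, hg, h, hh, hgh⟩ := hcomm
      exact hgh (commute_trans (hn ▸ hn0) (hSw g hg) (hSw h hh).symm)
    have := card_mul_self_of_commute hn0 hnm hwT hn (fun g hg => hTc g hg w hwT) hwmax hU hzU hzw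
    rw [hSTU] at this
    have := hTne.card_pos
    omega
  push Not at hTc
  have hTS : T ⊂ S := filter_ssubset.2 ⟨x, hxS, by simpa using hm⟩
  have ihT := ih T hTS ⟨u, huT, w, hwT, by omega⟩ hTc
  set V := T.filter fun g => g.level = n with hVdef
  have hVT : V ⊆ T := filter_subset _ _
  have hV : ∀ g ∈ V, g.level = n := fun g hg => (mem_filter.1 hg).2
  have hwV : w ∈ V := mem_filter.2 ⟨hwT, hn⟩
  have hVpos : 0 < #V := card_pos.2 ⟨w, hwV⟩
  have hlayers := card_add_card_add_card_le hnm hVT hwmax hV hU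
  rw [hSTU] at hlayers
  have hUU := card_mul_self_of_level_pos (hn0.trans hnm) hU
  have hUV := (cauchy_davenport_mul_of_linearOrder_isCancelMul ⟨x, hxU⟩
    (⟨w, hwV⟩ : V.Nonempty)).trans (card_le_card (subset_union_left (s₂ := V * U)))
  -- The order bounds give 4|U| + |V| - 3 new products, at least 3.5|U| once both slices have two
  -- elements. A singleton slice needs non-commutation to gain more.
  rcases Nat.lt_or_ge #V 2 with hV1 | hV2
  · have hVw : V = {w} := by
      obtain ⟨a, ha⟩ := card_eq_one.1 (by omega : #V = 1)
      rw [ha, mem_singleton] at hwV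
      rw [ha, hwV]
    rcases Nat.lt_or_ge #U 2 with hU1 | hU2
    · have hUx : U = {x} := by
        obtain ⟨a, ha⟩ := card_eq_one.1 (by omega : #U = 1)
        rw [ha, mem_singleton] at hxU
        rw [ha, hxU]
      obtain ⟨y, hyT, hxy⟩ : ∃ y ∈ T, ¬ Commute x y := by
        by_contra! hall
        obtain ⟨g, hg, h, hh, hgh⟩ := hTc
        exact hgh (commute_trans (by omega) (hall g hg).symm (hall h hh))
      -- The two top layers hold at most three products, `x * w`, `w * x` and `x * x`, short of 3.5;
      -- a fourth must come from lower levels.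
      have h4 := card_add_four_le hn0 hnm hm hwT hn (fun g hg hgw => by
        refine lt_of_le_of_ne (hwmax g hg) fun hgn => hgw ?_
        rw [← mem_singleton, ← hVw]
        exact mem_filter.2 ⟨hg, hgn⟩) hyT hxy ⟨u, huT, fun h => by subst h; omega⟩
      rw [← hUx, hSTU] at h4
      omega
    · obtain ⟨z, hzU, hwz⟩ := exists_not_commute (x := w) hU hU2 (hn ▸ hn0)
      have := card_lt_card_mul_union_mul hzU hwz
      rw [union_comm, ← hVw] at this
      omega
  · rcases Nat.lt_or_ge #U 2 with hU1 | hU2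
    · have hUx : U = {x} := by
        obtain ⟨a, ha⟩ := card_eq_one.1 (by omega : #U = 1)
        rw [ha, mem_singleton] at hxU
        rw [ha, hxU]
      obtain ⟨z, hzV, hxz⟩ := exists_not_commute (x := x) hV hV2 (by omega)
      have := card_lt_card_mul_union_mul hzV hxz
      rw [← hUx] at this
      omega
    · omega

end LevelPair

/-! ### Faithfulness of the encoding, through the affine action on ℚ. -/

namespace BaumslagSolitar

/-- The action of `BS(1, 2)` on the rational line: `a` is the translation by `1` and `b` halves. -/
noncomputable def affineHom : BaumslagSolitar 1 2 →* Equiv.Perm ℚ :=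
  PresentedGroup.toGroup (f := ![Equiv.addRight 1, Equiv.mulRight₀ (2⁻¹ : ℚ) (by norm_num)]) (by
    intro r hr
    rw [Set.mem_singleton_iff.1 hr, baumslagSolitarRel]
    simp only [map_mul, map_inv, map_zpow, FreeGroup.lift_apply_of, mul_inv_eq_one]
    ext y
    simp [Equiv.Perm.mul_apply]
    ring)

theorem affineHom_a_zpow_apply (x : ℤ) (y : ℚ) : affineHom (a 1 2 ^ x) y = y + x := by
  have : affineHom (a 1 2) = Equiv.addRight 1 := PresentedGroup.toGroup.of _
  rw [map_zpow, this]
  simp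

theorem affineHom_b_pow_apply (m : ℕ) (y : ℚ) : affineHom (b 1 2 ^ m) y = y * 2⁻¹ ^ m := by
  have : affineHom (b 1 2) = Equiv.mulRight₀ (2⁻¹ : ℚ) (by norm_num) := PresentedGroup.toGroup.of _
  rw [map_pow, this]
  induction m with
  | zero => simp
  | succ m ih => rw [pow_succ', Equiv.Perm.mul_apply, ih]; simp [pow_succ, mul_assoc]

/-- The element of `BS⁺(1, 2)` encoded by a pair. -/
def ofLevelPair (g : LevelPair) : BaumslagSolitar 1 2 := b 1 2 ^ g.level * a 1 2 ^ g.shift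

theorem ofLevelPair_mul (g h : LevelPair) :
    ofLevelPair (g * h) = ofLevelPair g * ofLevelPair h := by
  rw [ofLevelPair, ofLevelPair, ofLevelPair, LevelPair.level_mul, LevelPair.shift_mul, pow_add,
    zpow_add, mul_assoc, mul_assoc, ← mul_assoc (a 1 2 ^ g.shift), a_zpow_mul_b_pow_one_two]
  simp only [mul_assoc]

theorem ofLevelPair_injective : Function.Injective ofLevelPair := by
  intro g h hgh
  have key : ∀ y : ℚ, (y + g.shift) * 2⁻¹ ^ g.level = (y + h.shift) * 2⁻¹ ^ h.level := by
    intro y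
    have := congrArg (fun k => affineHom k y) hgh
    simpa only [ofLevelPair, map_mul, Equiv.Perm.mul_apply, affineHom_a_zpow_apply,
      affineHom_b_pow_apply] using this
  have hpow : (2⁻¹ : ℚ) ^ g.level = 2⁻¹ ^ h.level := by linear_combination key 1 - key 0
  have hlev : g.level = h.level :=
    pow_right_injective₀ (by norm_num) (by norm_num) hpow
  have h0 := key 0
  rw [hpow] at h0
  have := mul_right_cancel₀ (pow_ne_zero _ (by norm_num)) h0
  exact LevelPair.ext hlev (by simpa using this)

end BaumslagSolitar

open BaumslagSolitar in
theorem lemma6p7 (S : Set (BaumslagSolitar 1 2)) (hfin : S.Finite)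
    (hS : S ⊆ (BSPlus : Set (BaumslagSolitar 1 2)))
    (hnonab : S.IsNonabelian)
    (hcosets : ∃ g ∈ S, ∃ h ∈ S,
      (QuotientGroup.mk g : BaumslagSolitar 1 2 ⧸ Subgroup.zpowers (BaumslagSolitar.a 1 2)) ≠
        QuotientGroup.mk h) :
    (3.5 : ℝ) * (S.ncard : ℝ) - 4 ≤ ((S * S).ncard : ℝ) := by
  classical
  set F : Set LevelPair := ofLevelPair ⁻¹' S
  have hFfin : F.Finite := hfin.preimage ofLevelPair_injective.injOn
  have hFS : ofLevelPair '' F = S := Set.image_preimage_eq_of_subset fun g hg => by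
    obtain ⟨m, x, h⟩ := hS hg
    exact ⟨⟨m, x⟩, h.symm⟩
  lift F to Finset LevelPair using hFfin with P
  have hmem : ∀ g ∈ S, ∃ p ∈ P, ofLevelPair p = g := by
    intro g hg
    rw [← hFS] at hg
    simpa using hg
  have hSS : S * S = ofLevelPair '' ((P * P : Finset LevelPair) : Set LevelPair) := by
    rw [← hFS, Finset.coe_mul]
    exact (Set.image_mul (⟨ofLevelPair, ofLevelPair_mul⟩ : LevelPair →ₙ* _)).symm
  have hcardS : S.ncard = P.card := by
    rw [← hFS, Set.ncard_image_of_injective _ ofLevelPair_injective, Set.ncard_coe_finset]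
  have hcardSS : (S * S).ncard = (P * P).card := by
    rw [hSS, Set.ncard_image_of_injective _ ofLevelPair_injective, Set.ncard_coe_finset]
  have hlev : ∃ g ∈ P, ∃ h ∈ P, g.level < h.level := by
    obtain ⟨g, hg, h, hh, hgh⟩ := hcosets
    obtain ⟨p, hp, rfl⟩ := hmem g hg
    obtain ⟨q, hq, rfl⟩ := hmem h hh
    have : p.level ≠ q.level := by
      intro heq
      refine hgh (QuotientGroup.eq.2 (Subgroup.mem_zpowers_iff.2 ⟨q.shift - p.shift, ?_⟩))
      rw [ofLevelPair, ofLevelPair, heq]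
      group
    rcases this.lt_or_gt with h | h
    · exact ⟨p, hp, q, hq, h⟩
    · exact ⟨q, hq, p, hp, h⟩
  have hcomm : ∃ g ∈ P, ∃ h ∈ P, ¬ Commute g h := by
    by_contra! hall
    refine hnonab fun g hg h hh => ?_
    have hc : ∀ x ∈ S, ∀ y ∈ S, x * y = y * x := by
      intro x hx y hy
      obtain ⟨p, hp, rfl⟩ := hmem x hx
      obtain ⟨q, hq, rfl⟩ := hmem y hy
      rw [← ofLevelPair_mul, (hall p hp q hq).eq, ofLevelPair_mul]
    have := Subgroup.isMulCommutative_closure hc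
    exact congrArg Subtype.val (mul_comm' (⟨g, hg⟩ : Subgroup.closure S) ⟨h, hh⟩)
  have := LevelPair.seven_mul_card_le P hlev hcomm
  rw [hcardS, hcardSS]
  have : (7 : ℝ) * P.card ≤ 2 * (P * P).card + 8 := by exact_mod_cast this
  linarith
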